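/- Let $X$ be a complex Banach space with open unit ball $B_X$ and bidual $X^{**}$; let $B_{X^{**}}$ and $S_{X^{**}}$ be the open unit ball and the unit sphere of $X^{**}$. Let $\mathcal H^\infty(B_X)$ be the algebra of bounded holomorphic functions $f\colon B_X\to\mathbb C$ with the supremum norm, $\mathcal A_u(B_X)$ its subalgebra of uniformly continuous functions, and let $\mathcal A$ be either $\mathcal A_u(B_X)$ or $\mathcal H^\infty(B_X)$. Let $\mathcal M(\mathcal A)$ be the set of nonzero algebra homomorphisms $\varphi\colon\mathcal A\to\mathbb C$. For $\varphi,\psi\in\mathcal M(\mathcal A)$ put $$\rho(\varphi,\psi)=\sup\{|\varphi(f)| : f\in\mathcal A,\ \|f\|\le 1,\ \psi(f)=0\},\qquad \mathcal{GP}(\varphi)=\{\psi\in\mathcal M(\mathcal A) : \rho(\varphi,\psi)<1\}$$ (the Gleason part of $\varphi$). For $z\in X^{**}$ with $\|z\|\le 1$, let $\mathcal M_z$ be the fiber over $z$, that is, the set of $\varphi\in\mathcal M(\mathcal A)$ with $\varphi(x^*|_{B_X})=z(x^*)$ for all $x^*\in X^*$. For $f\in\mathcal A$ with Taylor series $\sum_n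 P_n$ at $0$, where $P_n(x)=T_n(x,\dots,x)$ with $T_n$ a continuous symmetric $n$-linear form, let $\tilde f(z)=\sum_n \tilde T_n(z,\dots,z)$, $z\in B_{X^{**}}$, be its canonical (Aron–Berner) extension, where $$\tilde T_n(z_1,\dots,z_n)=\lim_{x_1\to z_1}\cdots\lim_{x_n\to z_n}T_n(x_1,\dots,x_n)$$ is the iterated weak-star limit over $x_i\in X$. (a) For every $z\in B_{X^{**}}$ the series defining $\tilde f(z)$ converges for each $f\in\mathcal A$, and $\delta_z(f)=\tilde f(z)$ defines an element $\delta_z$ of $\mathcal M(\mathcal A)$. The set $\{\delta_z : z\in B_{X^{**}}\}$ is contained in $\mathcal{GP}(\delta_0)$; in fact $\rho(\delta_0,\delta_z)=\|z\|$ for each $z\in B_{X^{**}}$. (b) Let $z\in S_{X^{**}}$ and $w\in B_{X^{**}}$. Then for any $\varphi\in\mathcal M_z$ and $\psi\in\mathcal M_w$ we have $\rho(\varphi,\psi)=1$; that is, $\varphi$ and $\psi$ lie in different Gleason parts: $\mathcal{GP}(\varphi)\neq\mathcal{GP}(\psi)$. -/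

import Mathlib

open scoped BoundedContinuousFunction

noncomputable section

namespace BallAlgebra

/-- The bidual `X**`, with its norm. -/
abbrev Bidual (X : Type*) [NormedAddCommGroup X] [NormedSpace ℂ X] : Type _ :=
  StrongDual ℂ (StrongDual ℂ X)

/-- The open unit ball `B_X`, as a type. -/
abbrev UnitBall (X : Type*) [NormedAddCommGroup X] : Type _ :=
  Metric.ball (0 : X) 1

/-- A function on `B_X`, regarded as a function on `X` (with value `0` off the ball), so that
one can speak of its analyticity and its derivatives at points of the open ball. -/
def ext0 {X : Type*} [NormedAddCommGroup X] (f : UnitBall X → ℂ) : X → ℂ :=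
  Function.extend Subtype.val f 0

theorem ext0_apply {X : Type*} [NormedAddCommGroup X] (f : UnitBall X → ℂ) (x : UnitBall X) :
    ext0 f x = f x :=
  Subtype.val_injective.extend_apply f 0 x

/-- `f : B_X → ℂ` is holomorphic, that is, complex-analytic at every point of `B_X`. -/
def IsHolo {X : Type*} [NormedAddCommGroup X] [NormedSpace ℂ X] (f : UnitBall X → ℂ) : Prop :=
  AnalyticOnNhd ℂ (ext0 f) (Metric.ball (0 : X) 1)

theorem isHolo_of_eq {X : Type*} [NormedAddCommGroup X] [NormedSpace ℂ X]
    {f : UnitBall X → ℂ} {g : X → ℂ} (hg : AnalyticOnNhd ℂ g (Metric.ball (0 : X) 1))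
    (h : ∀ x : UnitBall X, f x = g x) : IsHolo f := by
  refine AnalyticOnNhd.congr Metric.isOpen_ball hg ?_
  intro x hx
  exact ((ext0_apply f ⟨x, hx⟩).trans (h ⟨x, hx⟩)).symm

/-- `H^∞(B_X)`: the bounded holomorphic functions on `B_X`, with the supremum norm. -/
def Hinf (X : Type*) [NormedAddCommGroup X] [NormedSpace ℂ X] :
    Subalgebra ℂ (UnitBall X →ᵇ ℂ) where
  carrier := {f | IsHolo f}
  mul_mem' {f g} hf hg := isHolo_of_eq (AnalyticOnNhd.mul hf hg) fun x => by
    simp [ext0_apply]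
  add_mem' {f g} hf hg := isHolo_of_eq (AnalyticOnNhd.add hf hg) fun x => by
    simp [ext0_apply]
  algebraMap_mem' c := isHolo_of_eq (analyticOnNhd_const (v := c)) fun x => by
    simp [BoundedContinuousFunction.algebraMap_apply]

theorem uniformContinuous_mul {X : Type*} [NormedAddCommGroup X] {f g : UnitBall X →ᵇ ℂ}
    (hf : UniformContinuous f) (hg : UniformContinuous g) : UniformContinuous (f * g) := by
  rw [Metric.uniformContinuous_iff] at hf hg ⊢
  intro ε hε
  have hM : 0 < ‖f‖ + ‖g‖ + 1 := by positivity
  obtain ⟨d₁, hd₁, h₁⟩ := hf (ε / (2 * (‖f‖ + ‖g‖ + 1))) (by positivity)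
  obtain ⟨d₂, hd₂, h₂⟩ := hg (ε / (2 * (‖f‖ + ‖g‖ + 1))) (by positivity)
  refine ⟨min d₁ d₂, lt_min hd₁ hd₂, fun {a b} hab => ?_⟩
  have e₁ := h₁ (hab.trans_le (min_le_left _ _))
  have e₂ := h₂ (hab.trans_le (min_le_right _ _))
  rw [dist_eq_norm] at e₁ e₂ ⊢
  have key : (f * g) a - (f * g) b = f a * (g a - g b) + (f a - f b) * g b := by
    simp only [BoundedContinuousFunction.coe_mul, Pi.mul_apply]; ring
  rw [key]
  have n₁ : ‖f a * (g a - g b)‖ ≤ (‖f‖ + ‖g‖ + 1) * ‖g a - g b‖ := by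
    rw [norm_mul]
    gcongr
    linarith [f.norm_coe_le_norm a, norm_nonneg g]
  have n₂ : ‖(f a - f b) * g b‖ ≤ ‖f a - f b‖ * (‖f‖ + ‖g‖ + 1) := by
    rw [norm_mul]
    gcongr
    linarith [g.norm_coe_le_norm b, norm_nonneg f]
  rw [lt_div_iff₀ (by positivity)] at e₁ e₂
  calc _ ≤ _ := norm_add_le _ _
    _ ≤ _ := add_le_add n₁ n₂
    _ < ε := by linarith

/-- `A_u(B_X)`: the uniformly continuous holomorphic functions on `B_X`, with the supremum norm.
(A uniformly continuous function on `B_X` is automatically bounded.) -/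
def Au (X : Type*) [NormedAddCommGroup X] [NormedSpace ℂ X] :
    Subalgebra ℂ (UnitBall X →ᵇ ℂ) where
  carrier := {f | IsHolo f ∧ UniformContinuous f}
  mul_mem' hf hg := ⟨(Hinf X).mul_mem hf.1 hg.1, uniformContinuous_mul hf.2 hg.2⟩
  add_mem' hf hg := ⟨(Hinf X).add_mem hf.1 hg.1, hf.2.add hg.2⟩
  algebraMap_mem' c := ⟨(Hinf X).algebraMap_mem c, uniformContinuous_const⟩

/-- The restriction to `B_X` of a functional in `X*`. -/
def restrictDual {X : Type*} [NormedAddCommGroup X] [NormedSpace ℂ X] (L : StrongDual ℂ X) :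
    UnitBall X →ᵇ ℂ :=
  BoundedContinuousFunction.ofNormedAddCommGroup (fun x : UnitBall X => L x)
    (L.continuous.comp continuous_subtype_val) ‖L‖ fun x => by
      have hx : ‖(x : X)‖ < 1 := mem_ball_zero_iff.mp x.2
      exact (L.le_opNorm x).trans (mul_le_of_le_one_right (norm_nonneg L) hx.le)

/-- `X* ⊂ A` for both algebras. -/
theorem restrictDual_mem {X : Type*} [NormedAddCommGroup X] [NormedSpace ℂ X]
    {A : Subalgebra ℂ (UnitBall X →ᵇ ℂ)} (hA : A = Au X ∨ A = Hinf X) (L : StrongDual ℂ X) :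
    restrictDual L ∈ A := by
  have h : IsHolo (restrictDual L) := isHolo_of_eq (L.analyticOnNhd _) fun x => rfl
  rcases hA with rfl | rfl
  · exact ⟨h, L.uniformContinuous.comp uniformContinuous_subtype_val⟩
  · exact h

/-- The pseudo-hyperbolic distance on the spectrum `M(A)`, the set of nonzero (equivalently,
unital) homomorphisms `A → ℂ`. -/
def rho {X : Type*} [NormedAddCommGroup X] {A : Subalgebra ℂ (UnitBall X →ᵇ ℂ)}
    (φ ψ : A →ₐ[ℂ] ℂ) : ℝ :=
  sSup {r : ℝ | ∃ f : A, ‖f‖ ≤ 1 ∧ ψ f = 0 ∧ r = ‖φ f‖}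

/-- The Gleason part of `φ`. -/
def GP {X : Type*} [NormedAddCommGroup X] {A : Subalgebra ℂ (UnitBall X →ᵇ ℂ)}
    (φ : A →ₐ[ℂ] ℂ) : Set (A →ₐ[ℂ] ℂ) :=
  {ψ | rho φ ψ < 1}

/-- The fiber `M_z` of the spectrum over `z`: the homomorphisms whose restriction to `X*`
is `z`. -/
def fiber {X : Type*} [NormedAddCommGroup X] [NormedSpace ℂ X]
    {A : Subalgebra ℂ (UnitBall X →ᵇ ℂ)} (hA : A = Au X ∨ A = Hinf X) (z : Bidual X) :
    Set (A →ₐ[ℂ] ℂ) :=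
  {φ | ∀ L : StrongDual ℂ X, φ ⟨restrictDual L, restrictDual_mem hA L⟩ = z L}

/-- The canonical (Aron–Berner) extension of a continuous `n`-linear form `T` on `X` to the
bidual, `T ↦ T̃(z₁, …, zₙ)`. It is defined one variable at a time:
`T̃(z₁, …, zₙ₊₁) = z₁ (x ↦ T(x, ·, …, ·)~(z₂, …, zₙ₊₁))`. Since `z(L) = lim L(x_α)` for every
`L ∈ X*` whenever `x_α → z` weak-star, this is the iterated weak-star limit
`lim_{x₁ → z₁} ⋯ lim_{xₙ → zₙ} T(x₁, …, xₙ)`. -/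
def multilinearExtension {X : Type*} [NormedAddCommGroup X] [NormedSpace ℂ X] :
    (n : ℕ) → (Fin n → Bidual X) →
      (ContinuousMultilinearMap ℂ (fun _ : Fin n => X) ℂ →L[ℂ] ℂ)
  | 0, _ =>
      ((continuousMultilinearCurryFin0 ℂ X ℂ).toContinuousLinearEquiv :
        ContinuousMultilinearMap ℂ (fun _ : Fin 0 => X) ℂ →L[ℂ] ℂ)
  | n + 1, z =>
      (z 0).comp
        ((ContinuousLinearMap.compL ℂ X (ContinuousMultilinearMap ℂ (fun _ : Fin n => X) ℂ) ℂ
            (multilinearExtension n (Fin.tail z))).comp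
          ((continuousMultilinearCurryLeftEquiv ℂ (fun _ : Fin (n + 1) => X)
              ℂ).toContinuousLinearEquiv :
            ContinuousMultilinearMap ℂ (fun _ : Fin (n + 1) => X) ℂ →L[ℂ]
              (X →L[ℂ] ContinuousMultilinearMap ℂ (fun _ : Fin n => X) ℂ)))

/-- The symmetric `n`-linear form of the `n`-th Taylor polynomial of `f` at `0`. -/
def taylorForm {X : Type*} [NormedAddCommGroup X] [NormedSpace ℂ X] (f : UnitBall X → ℂ)
    (n : ℕ) : ContinuousMultilinearMap ℂ (fun _ : Fin n => X) ℂ :=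
  ((n.factorial : ℂ)⁻¹) • iteratedFDeriv ℂ n (ext0 f) 0

/-- `P̃ₙ(z)`, the canonical extension of the `n`-th homogeneous Taylor polynomial `Pₙ` of `f`
at `0`, evaluated at `z ∈ X**`. -/
def taylorExtension {X : Type*} [NormedAddCommGroup X] [NormedSpace ℂ X] (f : UnitBall X → ℂ)
    (z : Bidual X) (n : ℕ) : ℂ :=
  multilinearExtension n (fun _ => z) (taylorForm f n)

/-- The canonical extension `f̃(z) = ∑ₙ P̃ₙ(z)` of `f` to the open unit ball of `X**`. -/
def canonicalExtension {X : Type*} [NormedAddCommGroup X] [NormedSpace ℂ X]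
    (f : UnitBall X → ℂ) (z : Bidual X) : ℂ :=
  ∑' n, taylorExtension f z n

end BallAlgebra

end

open scoped BoundedContinuousFunction ComplexConjugate ContDiff

noncomputable section

namespace BallAlgebra

open Filter Topology

variable {X : Type*} [NormedAddCommGroup X] [NormedSpace ℂ X]

/-! The difficulty lies in (a): polynomials on `X` need not be weak-star continuous, so Goldstine's
theorem alone does not make `δ_z` a limit of point evaluations. The derivation `bidualDeriv z`,
which is differentiation in the direction `z`, resolves this. Its exponential, a finite sum on
polynomials, is translation by `t z`; at time 1 and base point 0 it gives the Aron–Berner extension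
at `z` (`bidualFlow_eq_multilinearExtension`). The translation is then traded for motion inside `X`
in `N` small steps: time drops by `1/N` while the base point moves by `x/N`, with `x` chosen by
Goldstine to imitate `z` on the current differentials. The total error is small, and the endpoint is
an average of points of norm less than `r`. This handles finitely many polynomials at once, hence
one filter handles them all, and Cauchy estimates pass to bounded holomorphic functions. Thus `δ_z`
is a limit of evaluations and therefore a character.

The bound `ρ(δ_0, δ_z) ≤ ‖z‖` is the Schwarz lemma on the complex disc through `z`. The lower bound
and (b) come from testing on Möbius transforms `(L - a) / (1 - conj a * L)` of functionals `L`
(`exists_moebius`), with `a` the value of `L` at `z`, respectively `w`. -/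

/-! ### Goldstine's theorem -/

/-- Goldstine's theorem, for finitely many functionals. -/
theorem exists_norm_lt_forall_norm_sub_lt {ι : Type*} [Finite ι] (l : ι → StrongDual ℂ X)
    (z : Bidual X) {r ε : ℝ} (hz : ‖z‖ < r) (hε : 0 < ε) :
    ∃ x : X, ‖x‖ < r ∧ ∀ i, ‖l i x - z (l i)‖ < ε := by
  classical
  have := Fintype.ofFinite ι
  have hr : 0 < r := (norm_nonneg z).trans_lt hz
  let Λ : X →L[ℂ] (ι → ℂ) := ContinuousLinearMap.pi l
  have hmem : (fun i => z (l i)) ∈ closure (Λ '' Metric.ball (0 : X) r) := by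
    -- Otherwise a functional separates the point from the closed convex image. Pulled back to `X`
    -- it gives `L` with real part below `u` on the `r`-ball, yet `Re z(L) > u`.
    by_contra hy
    have hconv : Convex ℝ (Λ '' Metric.ball (0 : X) r) :=
      (convex_ball (0 : X) r).is_linear_image
        (Λ.toLinearMap.restrictScalars ℝ).isLinear
    obtain ⟨f, u, hu, hfy⟩ := RCLike.geometric_hahn_banach_closed_point (𝕜 := ℂ)
      hconv.closure isClosed_closure hy
    let L : StrongDual ℂ X := f.comp Λ
    have hLx : ∀ x : X, ‖x‖ < r → (L x).re < u := fun x hx =>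
      hu _ (subset_closure ⟨x, by simpa using hx, rfl⟩)
    have hu0 : 0 < u := by simpa using hLx 0 (by simpa using hr)
    obtain ⟨s, hzs, hsr⟩ := exists_between hz
    have hs : 0 < s := (norm_nonneg z).trans_lt hzs
    -- Rotating `x` by a unimodular scalar turns the bound on real parts into a bound on `‖L x‖`; `s
    -- < r` puts the closed `s`-ball inside the open `r`-ball.
    have hL : ‖L‖ ≤ u / s := by
      refine ContinuousLinearMap.opNorm_bound_of_ball_bound hs u L fun x hx => ?_
      obtain ⟨c, hc, hcx⟩ := Complex.exists_norm_eq_mul_self (L x)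
      have h := hLx (c • x) (by
        rw [norm_smul, hc, one_mul]
        exact (mem_closedBall_zero_iff.1 hx).trans_lt hsr)
      rw [map_smul, smul_eq_mul, ← hcx, Complex.ofReal_re] at h
      exact h.le
    have hzL : f (fun i => z (l i)) = z L := by
      have h1 : ∀ v : ι → ℂ, f v = ∑ i, v i * f (Pi.single i 1) := fun v => by
        conv_lhs => rw [pi_eq_sum_univ' v]
        simp [map_sum]
      have h2 : L = ∑ i, f (Pi.single i 1) • l i := by
        ext x
        simpa [L, Λ, mul_comm] using h1 (Λ x)
      rw [h2, h1]
      simp [mul_comm]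
    rw [hzL] at hfy
    have h3 : (z L).re ≤ ‖z‖ * (u / s) :=
      (Complex.re_le_norm _).trans ((z.le_opNorm L).trans (by gcongr))
    have h4 : ‖z‖ * (u / s) ≤ u := by
      rw [mul_div_assoc', div_le_iff₀ hs, mul_comm]
      gcongr
    exact absurd (hfy.trans_le (h3.trans h4)) (lt_irrefl u)
  obtain ⟨_, ⟨x, hx, rfl⟩, hd⟩ := Metric.mem_closure_iff.1 hmem ε hε
  refine ⟨x, by simpa using hx, fun i => ?_⟩
  rw [dist_comm, dist_pi_lt_iff hε] at hd
  simpa [dist_eq_norm, Λ] using hd i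

/-! ### Bounds for polynomials on bounded sets -/

/-- A function with a finite power series at `0` is bounded on bounded sets. -/
theorem exists_norm_le_of_hasFiniteFPowerSeriesOnBall {E F : Type*} [NormedAddCommGroup E]
    [NormedSpace ℂ E] [NormedAddCommGroup F] [NormedSpace ℂ F] {g : E → F}
    {p : FormalMultilinearSeries ℂ E F} {n : ℕ} (hg : HasFiniteFPowerSeriesOnBall g p 0 n ⊤)
    (R : ℝ) : ∃ C : ℝ, 0 ≤ C ∧ ∀ u, ‖u‖ ≤ R → ‖g u‖ ≤ C := by
  refine ⟨∑ k ∈ Finset.range n, ‖p k‖ * |R| ^ k, by positivity, fun u hu => ?_⟩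
  have h := hg.eq_partialSum u (by simp) n le_rfl
  rw [zero_add] at h
  rw [h, FormalMultilinearSeries.partialSum]
  refine (norm_sum_le _ _).trans (Finset.sum_le_sum fun k _ => ?_)
  refine ((p k).le_opNorm _).trans ?_
  simp only [Finset.prod_const, Finset.card_univ, Fintype.card_fin]
  gcongr
  exact hu.trans (le_abs_self R)

theorem differentiable_of_hasFiniteFPowerSeriesOnBall {E F : Type*} [NormedAddCommGroup E]
    [NormedSpace ℂ E] [NormedAddCommGroup F] [NormedSpace ℂ F] {g : E → F}
    {p : FormalMultilinearSeries ℂ E F} {n : ℕ} (hg : HasFiniteFPowerSeriesOnBall g p 0 n ⊤) :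
    Differentiable ℂ g := by
  rw [← differentiableOn_univ]
  simpa using hg.differentiableOn

/-- A function with a finite power series at `0` is Lipschitz on bounded sets. -/
theorem exists_norm_sub_le_of_hasFiniteFPowerSeriesOnBall {E F : Type*} [NormedAddCommGroup E]
    [NormedSpace ℂ E] [NormedAddCommGroup F] [NormedSpace ℂ F] {g : E → F}
    {p : FormalMultilinearSeries ℂ E F} {n : ℕ} (hg : HasFiniteFPowerSeriesOnBall g p 0 n ⊤)
    (R : ℝ) : ∃ C : ℝ, 0 ≤ C ∧ ∀ u v, ‖u‖ ≤ R → ‖v‖ ≤ R → ‖g u - g v‖ ≤ C * ‖u - v‖ := by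
  let _ : NormedSpace ℝ E := NormedSpace.restrictScalars ℝ ℂ E
  obtain ⟨C, hC0, hC⟩ := exists_norm_le_of_hasFiniteFPowerSeriesOnBall hg.fderiv' R
  refine ⟨C, hC0, fun u v hu hv => ?_⟩
  exact (convex_closedBall (0 : E) R).norm_image_sub_le_of_norm_fderiv_le (𝕜 := ℂ)
    (fun x _ => (differentiable_of_hasFiniteFPowerSeriesOnBall hg).differentiableAt)
    (fun x hx => hC x (by simpa using hx)) (by simpa using hv) (by simpa using hu)

/-! ### The derivation along a bidual vector and its flow -/

/-- The derivative of `g` in the direction of a bidual vector `z`. -/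
def bidualDeriv (z : Bidual X) (g : X → ℂ) (u : X) : ℂ := z (fderiv ℂ g u)

/-- Each application composes `z` with a derivative, so it lowers the degree bound by one. The
exponential series of the derivation is therefore a finite sum. -/
theorem exists_iterate_bidualDeriv {z : Bidual X} {g : X → ℂ}
    {p : FormalMultilinearSeries ℂ X ℂ} {n : ℕ} (hg : HasFiniteFPowerSeriesOnBall g p 0 n ⊤)
    (j : ℕ) : ∃ q : FormalMultilinearSeries ℂ X ℂ,
      HasFiniteFPowerSeriesOnBall ((bidualDeriv z)^[j] g) q 0 (n - j) ⊤ := by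
  induction j with
  | zero => exact ⟨p, hg⟩
  | succ j ih =>
    obtain ⟨q, hq⟩ := ih
    rw [Function.iterate_succ_apply']
    exact ⟨_, z.comp_hasFiniteFPowerSeriesOnBall hq.fderiv'⟩

theorem iterate_bidualDeriv_eq_zero {z : Bidual X} {g : X → ℂ}
    {p : FormalMultilinearSeries ℂ X ℂ} {n : ℕ} (hg : HasFiniteFPowerSeriesOnBall g p 0 n ⊤)
    {j : ℕ} (hj : n ≤ j) (u : X) : (bidualDeriv z)^[j] g u = 0 := by
  obtain ⟨q, hq⟩ := exists_iterate_bidualDeriv (z := z) hg j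
  rw [Nat.sub_eq_zero_of_le hj] at hq
  exact hq.eq_zero_of_bound_zero u (by simp)

/-- The truncated flow of the derivation `bidualDeriv z`: for a polynomial `g` of degree less
than `n` this is the canonical extension of `g` at `u + t z`. -/
def bidualFlow (n : ℕ) (z : Bidual X) (g : X → ℂ) (t : ℂ) (u : X) : ℂ :=
  ∑ j ∈ Finset.range n, t ^ j / (j.factorial : ℂ) * (bidualDeriv z)^[j] g u

/-- The differential of `bidualFlow` in the space variable. -/
def bidualFlowDeriv (n : ℕ) (z : Bidual X) (g : X → ℂ) (t : ℂ) (u : X) : StrongDual ℂ X :=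
  ∑ j ∈ Finset.range n, (t ^ j / (j.factorial : ℂ)) • fderiv ℂ ((bidualDeriv z)^[j] g) u

theorem bidualFlow_zero {z : Bidual X} {g : X → ℂ} {p : FormalMultilinearSeries ℂ X ℂ} {n : ℕ}
    (hg : HasFiniteFPowerSeriesOnBall g p 0 n ⊤) (u : X) : bidualFlow n z g 0 u = g u := by
  rcases n with _ | n
  · simp [bidualFlow, hg.eq_zero_of_bound_zero u (by simp)]
  · simp [bidualFlow, Finset.sum_range_succ']

theorem hasDerivAt_pow_div_factorial (j : ℕ) (t : ℂ) :
    HasDerivAt (fun s : ℂ => s ^ (j + 1) / ((j + 1).factorial : ℂ)) (t ^ j / (j.factorial : ℂ))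
      t := by
  have h := (hasDerivAt_pow (j + 1) t).div_const ((j + 1).factorial : ℂ)
  refine h.congr_deriv ?_
  have h1 : (j.factorial : ℂ) ≠ 0 := by exact_mod_cast j.factorial_ne_zero
  have h2 : ((j : ℂ) + 1) ≠ 0 := by exact_mod_cast j.succ_ne_zero
  rw [Nat.factorial_succ]
  push_cast
  field_simp

/-- Trading time for displacement along `x` changes the flow at the rate at which its differential
distinguishes `x` from `z`, a quantity that Goldstine's theorem can make small. -/
theorem hasDerivAt_bidualFlow {z : Bidual X} {g : X → ℂ} {p : FormalMultilinearSeries ℂ X ℂ}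
    {n : ℕ} (hg : HasFiniteFPowerSeriesOnBall g p 0 n ⊤) (t : ℂ) (u x : X) (τ : ℂ) :
    HasDerivAt (fun τ : ℂ => bidualFlow n z g (t - τ) (u + τ • x))
      (bidualFlowDeriv n z g (t - τ) (u + τ • x) x -
        z (bidualFlowDeriv n z g (t - τ) (u + τ • x))) τ := by
  set a : ℕ → X → ℂ := fun j => (bidualDeriv z)^[j] g with ha
  have hsub : HasDerivAt (fun τ : ℂ => t - τ) (-1) τ := by
    simpa using (hasDerivAt_id τ).const_sub t
  have hline : HasDerivAt (fun τ : ℂ => u + τ • x) x τ := by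
    simpa using ((hasDerivAt_id τ).smul_const x).const_add u
  have hA : ∀ j, HasDerivAt (fun τ : ℂ => a j (u + τ • x))
      (fderiv ℂ (a j) (u + τ • x) x) τ := fun j => by
    obtain ⟨q, hq⟩ := exists_iterate_bidualDeriv (z := z) hg j
    exact ((differentiable_of_hasFiniteFPowerSeriesOnBall hq).differentiableAt
      (x := u + τ • x)).hasFDerivAt.comp_hasDerivAt τ hline
  -- Differentiating the coefficients shifts the index, so the first `m` terms leave one boundary
  -- term containing `a m`. It is absent for `m = 0` and vanishes for `m = n` by the degree bound.
  have key : ∀ m, HasDerivAt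
      (fun τ : ℂ => ∑ j ∈ Finset.range m, (t - τ) ^ j / (j.factorial : ℂ) * a j (u + τ • x))
      (∑ j ∈ Finset.range m, (t - τ) ^ j / (j.factorial : ℂ) *
        (fderiv ℂ (a j) (u + τ • x) x - a (j + 1) (u + τ • x)) +
        (if m = 0 then 0 else (t - τ) ^ (m - 1) / ((m - 1).factorial : ℂ) * a m (u + τ • x)))
      τ := by
    intro m
    induction m with
    | zero => simpa using hasDerivAt_const τ (0 : ℂ)
    | succ m ih =>
      simp only [Finset.sum_range_succ]
      rcases m with _ | m
      · simpa using hA 0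
      · have h := ih.add (((hasDerivAt_pow_div_factorial m (t - τ)).comp τ hsub).mul (hA (m + 1)))
        refine h.congr_deriv ?_
        simp only [Function.comp]
        simp
        ring
  have h := key n
  have h0 : a n (u + τ • x) = 0 := iterate_bidualDeriv_eq_zero hg le_rfl _
  simp only [h0, mul_zero, ite_self, add_zero] at h
  refine h.congr_deriv ?_
  simp [bidualFlowDeriv, ha, Function.iterate_succ_apply', bidualDeriv, mul_sub,
    Finset.sum_sub_distrib]

theorem exists_norm_bidualFlowDeriv_sub_le {z : Bidual X} {g : X → ℂ}
    {p : FormalMultilinearSeries ℂ X ℂ} {n : ℕ} (hg : HasFiniteFPowerSeriesOnBall g p 0 n ⊤)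
    (R : ℝ) : ∃ C : ℝ, 0 ≤ C ∧ ∀ (s t : ℂ) (u v : X), ‖s‖ ≤ R → ‖t‖ ≤ R → ‖u‖ ≤ R → ‖v‖ ≤ R →
      ‖bidualFlowDeriv n z g s u - bidualFlowDeriv n z g t v‖ ≤ C * (‖s - t‖ + ‖u - v‖) := by
  have hj : ∀ j : ℕ, ∃ C : ℝ, 0 ≤ C ∧ ∀ (s t : ℂ) (u v : X), ‖s‖ ≤ R → ‖t‖ ≤ R → ‖u‖ ≤ R →
      ‖v‖ ≤ R → ‖(s ^ j / (j.factorial : ℂ)) • fderiv ℂ ((bidualDeriv z)^[j] g) u -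
        (t ^ j / (j.factorial : ℂ)) • fderiv ℂ ((bidualDeriv z)^[j] g) v‖ ≤
        C * (‖s - t‖ + ‖u - v‖) := by
    intro j
    obtain ⟨q, hq⟩ := exists_iterate_bidualDeriv (z := z) hg j
    obtain ⟨B, hB0, hB⟩ := exists_norm_le_of_hasFiniteFPowerSeriesOnBall hq.fderiv' R
    obtain ⟨K, hK0, hK⟩ := exists_norm_sub_le_of_hasFiniteFPowerSeriesOnBall hq.fderiv' R
    have hpow : ContDiff ℂ 1 (fun s : ℂ => s ^ j / (j.factorial : ℂ)) := by fun_prop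
    obtain ⟨M, hM⟩ := (isCompact_closedBall (0 : ℂ) R).exists_bound_of_continuousOn
      hpow.continuous.continuousOn
    obtain ⟨M', hM'⟩ := (isCompact_closedBall (0 : ℂ) R).exists_bound_of_continuousOn
      (hpow.continuous_deriv le_rfl).continuousOn
    refine ⟨|M'| * B + |M| * K, by positivity, fun s t u v hs ht hu hv => ?_⟩
    set c : ℂ → ℂ := fun s => s ^ j / (j.factorial : ℂ)
    set A : X → StrongDual ℂ X := fderiv ℂ ((bidualDeriv z)^[j] g)
    have h1 : ‖c s - c t‖ ≤ |M'| * ‖s - t‖ :=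
      (convex_closedBall (0 : ℂ) R).norm_image_sub_le_of_norm_deriv_le
        (fun y _ => (hpow.differentiable one_ne_zero).differentiableAt)
        (fun y hy => (hM' y hy).trans (le_abs_self M')) (by simpa using ht) (by simpa using hs)
    have h2 : ‖c t‖ ≤ |M| := (hM t (by simpa using ht)).trans (le_abs_self M)
    have h3 : c s • A u - c t • A v = (c s - c t) • A u + c t • (A u - A v) := by
      module
    change ‖c s • A u - c t • A v‖ ≤ _
    calc ‖c s • A u - c t • A v‖ ≤ ‖c s - c t‖ * ‖A u‖ + ‖c t‖ * ‖A u - A v‖ := by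
          rw [h3, ← norm_smul, ← norm_smul]
          exact norm_add_le _ _
      _ ≤ (|M'| * ‖s - t‖) * B + |M| * (K * ‖u - v‖) := by
          gcongr
          exacts [hB u hu, hK u v hu hv]
      _ ≤ _ := by
          have e1 : 0 ≤ |M'| * B * ‖u - v‖ := by positivity
          have e2 : 0 ≤ |M| * K * ‖s - t‖ := by positivity
          nlinarith
  choose C hC0 hC using hj
  refine ⟨∑ j ∈ Finset.range n, C j, Finset.sum_nonneg fun j _ => hC0 j,
    fun s t u v hs ht hu hv => ?_⟩
  rw [bidualFlowDeriv, bidualFlowDeriv, ← Finset.sum_sub_distrib, Finset.sum_mul]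
  exact (norm_sum_le _ _).trans (Finset.sum_le_sum fun j _ => hC j s t u v hs ht hu hv)

/-- One step of length `h`: the mean value inequality gives the first-order discrepancy between `x`
and `z`, plus an `O(h²)` error from the Lipschitz bound on the differential. -/
theorem exists_norm_bidualFlow_sub_le {z : Bidual X} {g : X → ℂ}
    {p : FormalMultilinearSeries ℂ X ℂ} {n : ℕ} (hg : HasFiniteFPowerSeriesOnBall g p 0 n ⊤)
    {R : ℝ} (hR : 0 ≤ R) :
    ∃ C : ℝ, 0 ≤ C ∧ ∀ (t h : ℝ) (u x : X), |t| ≤ R → 0 ≤ h → h ≤ 1 → ‖u‖ ≤ R → ‖x‖ ≤ R →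
      ‖bidualFlow n z g ((t - h : ℝ) : ℂ) (u + (h : ℂ) • x) - bidualFlow n z g t u‖ ≤
        h * (‖bidualFlowDeriv n z g t u x - z (bidualFlowDeriv n z g t u)‖ + C * h) := by
  -- For `|τ| ≤ h ≤ 1`, both `t - τ` and `u + τ • x` have norm at most `2R + 1`.
  obtain ⟨C, hC0, hC⟩ := exists_norm_bidualFlowDeriv_sub_le (z := z) hg (2 * R + 1)
  refine ⟨C * (1 + R) * (R + ‖z‖), by positivity, fun t h u x ht h0 h1 hu hx => ?_⟩
  set D : StrongDual ℂ X := bidualFlowDeriv n z g t u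
  have hbound : ∀ τ ∈ Metric.closedBall (0 : ℂ) h,
      ‖bidualFlowDeriv n z g (t - τ) (u + τ • x) x -
        z (bidualFlowDeriv n z g (t - τ) (u + τ • x))‖ ≤
      ‖D x - z D‖ + C * (1 + R) * (R + ‖z‖) * h := by
    intro τ hτ
    have hτ' : ‖τ‖ ≤ h := by simpa using hτ
    set D' : StrongDual ℂ X := bidualFlowDeriv n z g (t - τ) (u + τ • x)
    have hτx : ‖τ • x‖ ≤ h * R := by rw [norm_smul]; gcongr
    have htn : ‖(t : ℂ)‖ ≤ R := by simpa using ht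
    have hD : ‖D' - D‖ ≤ C * (h + h * R) := by
      refine (hC _ _ _ _ ?_ ?_ ?_ ?_).trans ?_
      · exact (norm_sub_le _ _).trans (by linarith)
      · linarith
      · exact (norm_add_le _ _).trans (by nlinarith)
      · linarith
      · simp only [sub_sub_cancel_left, norm_neg, add_sub_cancel_left]
        gcongr
    have e : D' x - z D' = (D x - z D) + ((D' - D) x - z (D' - D)) := by
      simp only [map_sub, sub_apply]
      ring
    rw [e]
    refine (norm_add_le _ _).trans ?_
    gcongr
    calc ‖(D' - D) x - z (D' - D)‖ ≤ ‖D' - D‖ * ‖x‖ + ‖z‖ * ‖D' - D‖ :=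
          (norm_sub_le _ _).trans (add_le_add ((D' - D).le_opNorm x) (z.le_opNorm _))
      _ ≤ ‖D' - D‖ * R + ‖z‖ * ‖D' - D‖ := by gcongr
      _ = ‖D' - D‖ * (R + ‖z‖) := by ring
      _ ≤ C * (h + h * R) * (R + ‖z‖) := by gcongr
      _ = _ := by ring
  have := (convex_closedBall (0 : ℂ) h).norm_image_sub_le_of_norm_hasDerivWithin_le
    (f := fun τ : ℂ => bidualFlow n z g (t - τ) (u + τ • x)) (x := 0) (y := (h : ℂ))
    (fun τ _ => (hasDerivAt_bidualFlow hg t u x τ).hasDerivWithinAt) hbound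
    (by simpa using h0) (by simp [abs_of_nonneg h0])
  simp only [sub_zero, zero_smul, add_zero, Complex.norm_real, Real.norm_eq_abs,
    abs_of_nonneg h0] at this
  push_cast
  rw [mul_comm h]
  exact this

/-! ### Simultaneous approximation for finitely many polynomials -/

/-- Points of the bidual ball are approximated from the ball simultaneously for finitely many
polynomials. -/
theorem exists_norm_le_forall_norm_sub_bidualFlow_le {ι : Type*} [Finite ι] {g : ι → X → ℂ}
    {p : ι → FormalMultilinearSeries ℂ X ℂ} {n : ι → ℕ}
    (hg : ∀ i, HasFiniteFPowerSeriesOnBall (g i) (p i) 0 (n i) ⊤)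
    {z : Bidual X} {r ε : ℝ} (hz : ‖z‖ < r) (hr : r ≤ 1) (hε : 0 < ε) :
    ∃ u : X, ‖u‖ ≤ r ∧ ∀ i, ‖g i u - bidualFlow (n i) z (g i) 1 0‖ ≤ ε := by
  have := Fintype.ofFinite ι
  have hr0 : 0 < r := (norm_nonneg z).trans_lt hz
  choose C hC0 hC using fun i => exists_norm_bidualFlow_sub_le (z := z) (hg i) zero_le_one
  -- With `N` this large the second-order part of a step costs at most `ε/2` per unit of time;
  -- Goldstine's theorem supplies the other `ε/2`.
  obtain ⟨N, hN⟩ := exists_nat_gt (max 1 ((∑ i, C i) / (ε / 2)))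
  have hN1 : (1 : ℝ) < N := (le_max_left _ _).trans_lt hN
  have hN0 : (0 : ℝ) < N := by linarith
  have hCN : ∀ i, C i * (1 / N) ≤ ε / 2 := fun i => by
    have h1 : C i ≤ ∑ i, C i := Finset.single_le_sum (fun i _ => hC0 i) (Finset.mem_univ i)
    have h2 := (le_max_right _ _).trans_lt hN
    rw [div_lt_iff₀ (by positivity)] at h2
    rw [mul_one_div, div_le_iff₀ hN0]
    linarith
  have key : ∀ k : ℕ, k ≤ N → ∃ u : X, ‖u‖ ≤ k / N * r ∧ ∀ i,
      ‖bidualFlow (n i) z (g i) ((1 - k / N : ℝ) : ℂ) u - bidualFlow (n i) z (g i) 1 0‖ ≤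
        k / N * ε := by
    intro k
    induction k with
    | zero => exact fun _ => ⟨0, by simp⟩
    | succ k ih =>
      intro hk
      obtain ⟨u, hu, hui⟩ := ih (by omega)
      have hkN : (k : ℝ) + 1 ≤ N := by exact_mod_cast hk
      have hk1 : (k : ℝ) / N ≤ 1 := by rw [div_le_one hN0]; linarith
      have hk0 : 0 ≤ (k : ℝ) / N := by positivity
      -- The differentials depend on the current point and time, so a new `x` is chosen at every
      -- step.
      obtain ⟨x, hx, hxi⟩ := exists_norm_lt_forall_norm_sub_lt
        (fun i => bidualFlowDeriv (n i) z (g i) ((1 - k / N : ℝ) : ℂ) u) z hz (half_pos hε)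
      have hh0 : (0 : ℝ) ≤ 1 / N := by positivity
      refine ⟨u + ((1 / N : ℝ) : ℂ) • x, ?_, fun i => ?_⟩
      · refine (norm_add_le _ _).trans ?_
        rw [norm_smul, Complex.norm_real, Real.norm_eq_abs, abs_of_nonneg hh0]
        calc ‖u‖ + 1 / N * ‖x‖ ≤ k / N * r + 1 / N * r := by gcongr
          _ = _ := by push_cast; ring
      · have h := hC i (1 - k / N) (1 / N) u x (by rw [abs_of_nonneg] <;> linarith) hh0
          (by rw [div_le_one hN0]; exact hN1.le) (hu.trans (by nlinarith)) (hx.le.trans hr)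
        have e : (1 - (k + 1 : ℕ) / N : ℝ) = 1 - k / N - 1 / N := by push_cast; ring
        rw [e]
        refine (norm_sub_le_norm_sub_add_norm_sub _ _ _).trans
          ((add_le_add h (hui i)).trans ?_)
        calc _ ≤ 1 / N * (ε / 2 + ε / 2) + k / N * ε := by
              gcongr
              exacts [(hxi i).le, hCN i]
          _ = _ := by push_cast; ring
  obtain ⟨u, hu, hui⟩ := key N le_rfl
  rw [div_self hN0.ne', one_mul] at hu
  refine ⟨u, hu, fun i => ?_⟩
  have := hui i
  rw [div_self hN0.ne', sub_self, one_mul, Complex.ofReal_zero, bidualFlow_zero (hg i)] at this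
  exact this

/-! ### The flow computes the Aron–Berner extension -/

theorem multilinearExtension_succ_apply (n : ℕ) (z : Fin (n + 1) → Bidual X)
    (T : ContinuousMultilinearMap ℂ (fun _ : Fin (n + 1) => X) ℂ) :
    multilinearExtension (n + 1) z T =
      z 0 ((multilinearExtension n (Fin.tail z)).comp
        (continuousMultilinearCurryLeftEquiv ℂ (fun _ : Fin (n + 1) => X) ℂ T)) :=
  rfl

theorem multilinearExtension_smul (n : ℕ) (c : ℂ) (z : Fin n → Bidual X)
    (T : ContinuousMultilinearMap ℂ (fun _ : Fin n => X) ℂ) :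
    multilinearExtension n (fun i => c • z i) T = c ^ n * multilinearExtension n z T := by
  induction n with
  | zero => simp [multilinearExtension]
  | succ n ih =>
    have h : multilinearExtension n (Fin.tail fun i => c • z i) =
        c ^ n • multilinearExtension n (Fin.tail z) := by
      ext S
      exact ih (Fin.tail z) S
    rw [multilinearExtension_succ_apply, multilinearExtension_succ_apply, h,
      ContinuousLinearMap.smul_comp, map_smul]
    simp only [smul_apply, smul_eq_mul]
    ring

/-- The extension treats the first variable outermost, which is the slot of the last derivative
taken. Each stage is the chain rule for a continuous linear map. -/
theorem iterate_bidualDeriv_eq_multilinearExtension {z : Bidual X} {g : X → ℂ}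
    (hg : ContDiff ℂ ω g) (j : ℕ) (u : X) :
    (bidualDeriv z)^[j] g u = multilinearExtension j (fun _ => z) (iteratedFDeriv ℂ j g u) := by
  induction j generalizing u with
  | zero => simp [multilinearExtension]
  | succ j ih =>
    have hd : DifferentiableAt ℂ (iteratedFDeriv ℂ j g) u :=
      (hg.differentiable_iteratedFDeriv (m := j) (by exact WithTop.coe_lt_top _)).differentiableAt
    have h : (bidualDeriv z)^[j] g =
        fun u => multilinearExtension j (fun _ => z) (iteratedFDeriv ℂ j g u) := funext ih
    rw [Function.iterate_succ_apply', h, bidualDeriv, multilinearExtension_succ_apply,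
      iteratedFDeriv_succ_eq_comp_left]
    simp only [Function.comp_apply, LinearIsometryEquiv.apply_symm_apply]
    congr 1
    exact ((multilinearExtension j fun _ => z).hasFDerivAt.comp u hd.hasFDerivAt).fderiv

/-- The power series whose only nonzero coefficient is `T`. -/
def monomialSeries {n : ℕ} (T : ContinuousMultilinearMap ℂ (fun _ : Fin n => X) ℂ) :
    FormalMultilinearSeries ℂ X ℂ :=
  Pi.single (M := fun n => ContinuousMultilinearMap ℂ (fun _ : Fin n => X) ℂ) n T

theorem monomialSeries_self {n : ℕ} (T : ContinuousMultilinearMap ℂ (fun _ : Fin n => X) ℂ) :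
    monomialSeries T n = T := Pi.single_eq_same _ _

theorem monomialSeries_of_ne {n m : ℕ} (T : ContinuousMultilinearMap ℂ (fun _ : Fin n => X) ℂ)
    (h : m ≠ n) : monomialSeries T m = 0 := Pi.single_eq_of_ne h _

theorem hasFiniteFPowerSeriesOnBall_monomialSeries {n : ℕ}
    (T : ContinuousMultilinearMap ℂ (fun _ : Fin n => X) ℂ) :
    HasFiniteFPowerSeriesOnBall (fun x => T fun _ => x) (monomialSeries T) 0 (n + 1) ⊤ := by
  have h := (monomialSeries T).hasFiniteFPowerSeriesOnBall_of_finite (n := n + 1)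
    fun m hm => monomialSeries_of_ne T (by omega)
  refine h.congr fun x _ => ?_
  rw [FormalMultilinearSeries.sum, tsum_eq_single n, monomialSeries_self]
  intro m hm
  rw [monomialSeries_of_ne T hm]
  rfl

/-- The canonical extension of a symmetric form is the flow of its homogeneous polynomial. -/
theorem bidualFlow_eq_multilinearExtension {n : ℕ}
    {T : ContinuousMultilinearMap ℂ (fun _ : Fin n => X) ℂ}
    (hT : ∀ (σ : Equiv.Perm (Fin n)) (v : Fin n → X), T (v ∘ σ) = T v) (z : Bidual X) :
    bidualFlow (n + 1) z (fun x => T fun _ => x) 1 0 = multilinearExtension n (fun _ => z) T := by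
  have hps := hasFiniteFPowerSeriesOnBall_monomialSeries T
  have hcd : ContDiff ℂ ω (fun x : X => T fun _ => x) := by
    have : AnalyticOnNhd ℂ (fun x : X => T fun _ => x) Set.univ := by
      simpa using hps.toHasFPowerSeriesOnBall.analyticOnNhd
    exact this.contDiff
  have hit : ∀ j v, iteratedFDeriv ℂ j (fun x : X => T fun _ => x) 0 v =
      ∑ σ : Equiv.Perm (Fin j), monomialSeries T j fun i => v (σ i) := fun j v =>
    hps.toHasFPowerSeriesOnBall.iteratedFDeriv_eq_sum_of_completeSpace v
  -- Symmetry of `T` collapses the sum over permutations to `n! • T`, which cancels the coefficient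
  -- `1 / n!` of the flow.
  have hself : iteratedFDeriv ℂ n (fun x : X => T fun _ => x) 0 = (n.factorial : ℂ) • T := by
    ext v
    rw [hit, monomialSeries_self]
    have : ∀ σ : Equiv.Perm (Fin n), (T fun i => v (σ i)) = T v := fun σ => hT σ v
    simp [this, Fintype.card_perm]
  have hne : ∀ j, j ≠ n → iteratedFDeriv ℂ j (fun x : X => T fun _ => x) 0 = 0 := by
    intro j hj
    ext v
    rw [hit, monomialSeries_of_ne T hj]
    simp
  have hn : (n.factorial : ℂ) ≠ 0 := by exact_mod_cast n.factorial_ne_zero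
  rw [bidualFlow, Finset.sum_eq_single n]
  · rw [iterate_bidualDeriv_eq_multilinearExtension hcd, hself, map_smul]
    simp [hn]
  · intro j _ hj
    rw [iterate_bidualDeriv_eq_multilinearExtension hcd, hne j hj]
    simp
  · simp

/-! ### One filter for all polynomials -/

/-- A filter on the ball of radius `r` along which all homogeneous polynomials converge to the
value at `z` of their canonical extensions. -/
theorem exists_filter_tendsto_multilinearExtension (z : Bidual X) {r : ℝ} (hz : ‖z‖ < r)
    (hr : r < 1) :
    ∃ l : Filter (UnitBall X), l.NeBot ∧ (∀ᶠ x : UnitBall X in l, ‖(x : X)‖ ≤ r) ∧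
      ∀ (n : ℕ) (T : ContinuousMultilinearMap ℂ (fun _ : Fin n => X) ℂ),
        (∀ (σ : Equiv.Perm (Fin n)) (v : Fin n → X), T (v ∘ σ) = T v) →
        Tendsto (fun x : UnitBall X => T fun _ => (x : X)) l
          (𝓝 (multilinearExtension n (fun _ => z) T)) := by
  let I : Type _ := Σ n : ℕ, {T : ContinuousMultilinearMap ℂ (fun _ : Fin n => X) ℂ //
    ∀ (σ : Equiv.Perm (Fin n)) (v : Fin n → X), T (v ∘ σ) = T v}
  let Φ : UnitBall X → I → ℂ := fun x T => T.2.1 fun _ => (x : X)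
  let y : I → ℂ := fun T => multilinearExtension T.1 (fun _ => z) T.2.1
  let S : Set (UnitBall X) := {x | ‖(x : X)‖ ≤ r}
  -- A neighbourhood in the product topology tests finitely many forms only, so simultaneous
  -- approximation suffices.
  have hy : y ∈ closure (Φ '' S) := by
    rw [mem_closure_iff_nhds]
    intro t ht
    rw [nhds_pi, Filter.mem_pi] at ht
    obtain ⟨J, hJ, t', ht', hsub⟩ := ht
    have hev : ∀ᶠ ε in 𝓝[>] (0 : ℝ), ∀ T ∈ J, Metric.closedBall (y T) ε ⊆ t' T := by
      refine (eventually_all_finite hJ).2 fun T _ => ?_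
      obtain ⟨ε, hε, hsubε⟩ := Metric.nhds_basis_closedBall.mem_iff.1 (ht' T)
      filter_upwards [Ioc_mem_nhdsGT hε] with δ hδ
      exact (Metric.closedBall_subset_closedBall hδ.2).trans hsubε
    obtain ⟨ε, hε, hε0⟩ := (hev.and self_mem_nhdsWithin).exists
    have := hJ.to_subtype
    obtain ⟨u, hu, hui⟩ := exists_norm_le_forall_norm_sub_bidualFlow_le
      (fun T : J => hasFiniteFPowerSeriesOnBall_monomialSeries T.1.2.1) hz hr.le hε0
    refine ⟨Φ ⟨u, by simpa using hu.trans_lt hr⟩, hsub fun T hT => hε T hT ?_, _, hu, rfl⟩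
    have := hui ⟨T, hT⟩
    rw [bidualFlow_eq_multilinearExtension T.2.2] at this
    rw [mem_closedBall_iff_norm]
    exact this
  refine ⟨𝓟 S ⊓ comap Φ (𝓝 y), ?_, ?_, fun n T hT => ?_⟩
  · rw [← map_neBot_iff Φ, Filter.push_pull, map_principal, inf_comm]
    exact mem_closure_iff_clusterPt.1 hy
  · exact mem_inf_of_left (mem_principal_self S)
  · have h : Tendsto Φ (𝓟 S ⊓ comap Φ (𝓝 y)) (𝓝 y) := tendsto_comap.mono_left inf_le_right
    exact (tendsto_pi_nhds.1 h) ⟨n, T, hT⟩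

/-! ### Taylor series and passage to bounded holomorphic functions -/

theorem taylorForm_comp_perm {f : UnitBall X → ℂ} (hf : IsHolo f) {n : ℕ}
    (σ : Equiv.Perm (Fin n)) (v : Fin n → X) : taylorForm f n (v ∘ σ) = taylorForm f n v := by
  have h : ContDiffAt ℂ ω (ext0 f) 0 := (hf 0 (by simp)).contDiffAt
  simp only [taylorForm, smul_apply, h.iteratedFDeriv_comp_perm]

/-- Reduces Taylor expansion on `X` to the slice `c ↦ f (c • x)`, where one-variable Cauchy theory
applies. -/
theorem iteratedDeriv_ext0_smul {f : UnitBall X → ℂ} (hf : IsHolo f) (x : X) (n : ℕ) :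
    iteratedDeriv n (fun c : ℂ => ext0 f (c • x)) 0 =
      iteratedFDeriv ℂ n (ext0 f) 0 fun _ => x := by
  let L : ℂ →L[ℂ] X := ContinuousLinearMap.toSpanSingleton ℂ x
  have hU : IsOpen (L ⁻¹' Metric.ball (0 : X) 1) := Metric.isOpen_ball.preimage L.continuous
  have h0 : (0 : ℂ) ∈ L ⁻¹' Metric.ball (0 : X) 1 := by simp
  have h := L.iteratedFDerivWithin_comp_right (i := n) (n := ω) (x := 0)
    (hf.contDiffOn (n := ω) Metric.isOpen_ball.uniqueDiffOn)
    Metric.isOpen_ball.uniqueDiffOn hU.uniqueDiffOn h0 le_top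
  rw [iteratedFDerivWithin_of_isOpen n hU h0,
    iteratedFDerivWithin_of_isOpen n Metric.isOpen_ball (by simp)] at h
  have h' := congrArg (fun T => T fun _ => (1 : ℂ)) h
  simpa [iteratedDeriv_eq_iteratedFDeriv, Function.comp_def, L] using h'

theorem norm_lt_one_of_mem_closedBall {x : X} {s : ℝ} (hx : ‖x‖ < s) {c : ℂ}
    (hc : c ∈ Metric.closedBall (0 : ℂ) s⁻¹) : ‖c • x‖ < 1 := by
  have hs : 0 < s := (norm_nonneg x).trans_lt hx
  have hc' : ‖c‖ ≤ s⁻¹ := by simpa using hc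
  calc ‖c • x‖ = ‖c‖ * ‖x‖ := norm_smul _ _
    _ ≤ s⁻¹ * ‖x‖ := by gcongr
    _ < s⁻¹ * s := by gcongr
    _ = 1 := inv_mul_cancel₀ hs.ne'

theorem differentiableOn_ext0_smul {f : UnitBall X → ℂ} (hf : IsHolo f) {x : X} {s : ℝ}
    (hx : ‖x‖ < s) :
    DifferentiableOn ℂ (fun c : ℂ => ext0 f (c • x)) (Metric.closedBall 0 s⁻¹) := fun c hc =>
  ((hf (c • x) (by simpa using norm_lt_one_of_mem_closedBall hx hc)).differentiableAt.comp c
    (by fun_prop : DifferentiableAt ℂ (fun c : ℂ => c • x) c)).differentiableWithinAt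

/-- The Taylor series at `0` converges on the whole ball. -/
theorem hasSum_taylorForm {f : UnitBall X → ℂ} (hf : IsHolo f) (x : UnitBall X) :
    HasSum (fun n => taylorForm f n fun _ => (x : X)) (f x) := by
  have hx : ‖(x : X)‖ < 1 := mem_ball_zero_iff.1 x.2
  obtain ⟨s, hxs, hs1⟩ := exists_between hx
  have hs : 0 < s := (norm_nonneg _).trans_lt hxs
  have h := Complex.hasSum_taylorSeries_on_ball (z := 1)
    ((differentiableOn_ext0_smul hf hxs).mono Metric.ball_subset_closedBall)
    (by simpa using (one_lt_inv₀ hs).2 hs1)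
  simpa [iteratedDeriv_ext0_smul hf, ext0_apply, taylorForm] using h

/-- Cauchy's estimate for the Taylor polynomials at `0`. -/
theorem norm_taylorForm_le {f : UnitBall X →ᵇ ℂ} (hf : IsHolo f) {x : X} {s : ℝ}
    (hx : ‖x‖ < s) (n : ℕ) : ‖taylorForm f n fun _ => x‖ ≤ ‖f‖ * s ^ n := by
  have hs : 0 < s := (norm_nonneg _).trans_lt hx
  have h := Complex.norm_iteratedDeriv_le_of_forall_mem_sphere_norm_le (C := ‖f‖) n
    (inv_pos.2 hs) ((differentiableOn_ext0_smul hf hx).diffContOnCl_ball subset_rfl) (by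
      intro c hc
      have hc1 := norm_lt_one_of_mem_closedBall hx (Metric.sphere_subset_closedBall hc)
      have := ext0_apply f ⟨c • x, by simpa using hc1⟩
      simp only at this
      rw [this]
      exact f.norm_coe_le_norm _)
  rw [iteratedDeriv_ext0_smul hf] at h
  have hn : (0 : ℝ) < n.factorial := by exact_mod_cast n.factorial_pos
  simp only [taylorForm, smul_apply, norm_smul, norm_inv,
    Complex.norm_natCast]
  rw [inv_mul_le_iff₀ hn]
  calc _ ≤ _ := h
    _ = _ := by rw [inv_pow, div_inv_eq_mul]; ring

theorem multilinearExtension_one (z : Bidual X) (L : StrongDual ℂ X) :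
    multilinearExtension 1 (fun _ => z) ((continuousMultilinearCurryFin1 ℂ X ℂ).symm L) =
      z L := by
  rw [multilinearExtension_succ_apply]
  congr 1

/-- Every point of the open bidual ball is the limit of a filter on the ball along which all
bounded holomorphic functions converge to their canonical extensions. -/
theorem exists_filter_tendsto_canonicalExtension (z : Bidual X) (hz : ‖z‖ < 1) :
    ∃ l : Filter (UnitBall X), l.NeBot ∧
      (∀ L : StrongDual ℂ X, Tendsto (fun x : UnitBall X => L x) l (𝓝 (z L))) ∧
      ∀ f : UnitBall X →ᵇ ℂ, IsHolo f →
        Summable (taylorExtension f z) ∧ Tendsto f l (𝓝 (canonicalExtension f z)) := by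
  obtain ⟨r, hzr, hr1⟩ := exists_between hz
  -- The filter lives on the `r`-ball. The gap `r < s < 1` gives the summable bound `‖f‖ * s ^ n`
  -- there, so dominated convergence exchanges limit and Taylor series.
  obtain ⟨s, hrs, hs1⟩ := exists_between hr1
  have hs : 0 ≤ s := (norm_nonneg z).trans (hzr.trans hrs).le
  obtain ⟨l, hl, hlr, hlT⟩ := exists_filter_tendsto_multilinearExtension z hzr hr1
  refine ⟨l, hl, fun L => ?_, fun f hf => ?_⟩
  · have h := hlT 1 ((continuousMultilinearCurryFin1 ℂ X ℂ).symm L) fun σ v => by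
      rw [Subsingleton.elim σ 1]
      rfl
    rw [multilinearExtension_one] at h
    exact h
  have hb : Summable fun n : ℕ => ‖f‖ * s ^ n :=
    (summable_geometric_of_lt_one hs hs1).mul_left _
  have hT : ∀ n, Tendsto (fun x : UnitBall X => taylorForm f n fun _ => (x : X)) l
      (𝓝 (taylorExtension f z n)) := fun n => hlT n _ (taylorForm_comp_perm hf)
  have hle : ∀ᶠ x : UnitBall X in l, ∀ n, ‖taylorForm f n fun _ => (x : X)‖ ≤ ‖f‖ * s ^ n := by
    filter_upwards [hlr] with x hx n using norm_taylorForm_le hf (hx.trans_lt hrs) n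
  refine ⟨.of_norm_bounded hb fun n => ?_, ?_⟩
  · exact le_of_tendsto (hT n).norm (hle.mono fun x hx => hx n)
  · have h := tendsto_tsum_of_dominated_convergence hb hT hle
    refine h.congr fun x => (hasSum_taylorForm hf x).tsum_eq

/-! ### Inverses in the algebra and contractivity of characters -/

theorem norm_coe_lt_one {E : Type*} [NormedAddCommGroup E] (x : UnitBall E) : ‖(x : E)‖ < 1 :=
  mem_ball_zero_iff.1 x.2

theorem exists_norm_eq_one_smul_eq {E : Type*} [NormedAddCommGroup E] [NormedSpace ℂ E] {z : E}
    (hz : z ≠ 0) : ∃ z₀ : E, ‖z₀‖ = 1 ∧ ((‖z‖ : ℝ) : ℂ) • z₀ = z := by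
  have h := norm_ne_zero_iff.2 hz
  refine ⟨((‖z‖⁻¹ : ℝ) : ℂ) • z, ?_, ?_⟩
  · rw [norm_smul, Complex.norm_real, norm_inv, norm_norm, inv_mul_cancel₀ h]
  · rw [smul_smul, ← Complex.ofReal_mul, mul_inv_cancel₀ h, Complex.ofReal_one, one_smul]

theorem smul_mem_ball_of_norm_eq_one {E : Type*} [NormedAddCommGroup E] [NormedSpace ℂ E]
    {z : E} (hz : ‖z‖ = 1) {c : ℂ} (hc : ‖c‖ < 1) : c • z ∈ Metric.ball (0 : E) 1 := by
  rwa [mem_ball_zero_iff, norm_smul, hz, mul_one]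

theorem isHolo_of_mem {A : Subalgebra ℂ (UnitBall X →ᵇ ℂ)} (hA : A = Au X ∨ A = Hinf X)
    {f : UnitBall X →ᵇ ℂ} (hf : f ∈ A) : IsHolo f := by
  rcases hA with rfl | rfl
  exacts [hf.1, hf]

/-- Elements of `A` that are bounded away from zero are invertible in `A`. -/
theorem exists_mul_eq_one_of_le_norm {A : Subalgebra ℂ (UnitBall X →ᵇ ℂ)}
    (hA : A = Au X ∨ A = Hinf X) (f : A) {c : ℝ} (hc : 0 < c)
    (hf : ∀ x, c ≤ ‖(f : UnitBall X →ᵇ ℂ) x‖) : ∃ g : A, g * f = 1 := by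
  obtain ⟨f, hfA⟩ := f
  replace hf : ∀ x, c ≤ ‖f x‖ := hf
  have h0 : ∀ x, f x ≠ 0 := fun x => norm_pos_iff.1 (hc.trans_le (hf x))
  let g : UnitBall X →ᵇ ℂ := BoundedContinuousFunction.ofNormedAddCommGroup
    (fun x => (f x)⁻¹) (f.continuous.inv₀ h0) c⁻¹ fun x => by
      rw [norm_inv]
      exact inv_anti₀ hc (hf x)
  have hg : IsHolo g := by
    refine isHolo_of_eq (g := fun x => (ext0 f x)⁻¹) ?_ fun x => ?_
    · refine AnalyticOnNhd.inv (isHolo_of_mem hA hfA) fun x hx => ?_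
      exact (ext0_apply f ⟨x, hx⟩).trans_ne (h0 _)
    · rw [ext0_apply]
      rfl
  have hgA : g ∈ A := by
    rcases hA with rfl | rfl
    · refine ⟨hg, ?_⟩
      have hu := Metric.uniformContinuous_iff.1 hfA.2
      refine Metric.uniformContinuous_iff.2 fun ε hε => ?_
      obtain ⟨d, hd, h⟩ := hu (ε * (c * c)) (by positivity)
      refine ⟨d, hd, fun {a b} hab => ?_⟩
      have h1 := h hab
      change dist (f a)⁻¹ (f b)⁻¹ < ε
      rw [dist_inv_inv₀ (h0 a) (h0 b)]
      rw [div_lt_iff₀ (mul_pos (norm_pos_iff.2 (h0 a)) (norm_pos_iff.2 (h0 b)))]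
      refine h1.trans_le ?_
      gcongr
      exacts [hf a, hf b]
    · exact hg
  refine ⟨⟨g, hgA⟩, Subtype.ext ?_⟩
  ext x
  exact inv_mul_cancel₀ (h0 x)

/-- If `‖f‖ < ‖φ f‖`, then `f - φ f` is bounded away from zero, hence invertible in `A`, although
`φ` kills it. -/
theorem norm_algHom_apply_le {A : Subalgebra ℂ (UnitBall X →ᵇ ℂ)} (hA : A = Au X ∨ A = Hinf X)
    (φ : A →ₐ[ℂ] ℂ) (f : A) : ‖φ f‖ ≤ ‖f‖ := by
  by_contra! h
  obtain ⟨g, hg⟩ := exists_mul_eq_one_of_le_norm hA (f - algebraMap ℂ A (φ f)) (sub_pos.2 h)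
    fun x => by
      have h1 := f.1.norm_coe_le_norm x
      have h2 := norm_sub_norm_le (φ f) (f.1 x)
      rw [norm_sub_rev] at h2
      change ‖φ f‖ - ‖f.1‖ ≤ ‖f.1 x - algebraMap ℂ (UnitBall X →ᵇ ℂ) (φ f) x‖
      simp only [BoundedContinuousFunction.algebraMap_apply, smul_eq_mul, mul_one]
      linarith
  have := congrArg φ hg
  rw [map_mul, map_sub, AlgHom.commutes, map_one] at this
  simp at this

/-! ### Möbius transforms of functionals and part (b) -/

theorem normSq_one_sub_conj_mul_sub (a ζ : ℂ) :
    ‖1 - conj a * ζ‖ ^ 2 - ‖ζ - a‖ ^ 2 = (1 - ‖ζ‖ ^ 2) * (1 - ‖a‖ ^ 2) := by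
  simp only [← Complex.normSq_eq_norm_sq, Complex.normSq_apply]
  simp
  ring

theorem one_sub_norm_le_norm_one_sub_conj_mul {a ζ : ℂ} (hζ : ‖ζ‖ ≤ 1) :
    1 - ‖a‖ ≤ ‖1 - conj a * ζ‖ := by
  have h := norm_sub_norm_le (1 : ℂ) (conj a * ζ)
  rw [norm_one, norm_mul, Complex.norm_conj] at h
  have := mul_le_of_le_one_right (norm_nonneg a) hζ
  linarith

/-- The Möbius transform `(L - a) / (1 - conj a * L)` of a functional `L` belongs to the unit
ball of `A`. -/
theorem exists_moebius {A : Subalgebra ℂ (UnitBall X →ᵇ ℂ)} (hA : A = Au X ∨ A = Hinf X)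
    {L : StrongDual ℂ X} (hL : ‖L‖ ≤ 1) {a : ℂ} (ha : ‖a‖ < 1) :
    ∃ m : A, ‖m‖ ≤ 1 ∧ ∀ (φ : A →ₐ[ℂ] ℂ) (z : Bidual X), φ ∈ fiber hA z →
      φ m * (1 - conj a * z L) = z L - a := by
  set l : A := ⟨restrictDual L, restrictDual_mem hA L⟩
  have hlx : ∀ x : UnitBall X, ‖L x‖ ≤ 1 := fun x =>
    (L.le_opNorm x).trans (mul_le_one₀ hL (norm_nonneg _) (mem_ball_zero_iff.1 x.2).le)
  have hd : ∀ x : UnitBall X, 1 - ‖a‖ ≤ ‖1 - conj a * L x‖ := fun x =>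
    one_sub_norm_le_norm_one_sub_conj_mul (hlx x)
  obtain ⟨g, hg⟩ := exists_mul_eq_one_of_le_norm hA (1 - conj a • l) (sub_pos.2 ha) hd
  refine ⟨(l - algebraMap ℂ A a) * g, ?_, fun φ z hφ => ?_⟩
  · refine (BoundedContinuousFunction.norm_le zero_le_one).2 fun x => ?_
    have hgx : g.1 x * (1 - conj a * L x) = 1 :=
      congrArg (fun f : A => (f : UnitBall X →ᵇ ℂ) x) hg
    have hval : ((l - algebraMap ℂ A a) * g).1 x = (L x - a) * g.1 x := by
      change (L x - algebraMap ℂ (UnitBall X →ᵇ ℂ) a x) * g.1 x = _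
      simp [BoundedContinuousFunction.algebraMap_apply]
    have hpos : 0 < ‖1 - conj a * L x‖ := (sub_pos.2 ha).trans_le (hd x)
    have hgn : ‖g.1 x‖ = ‖1 - conj a * L x‖⁻¹ := by
      rw [eq_inv_of_mul_eq_one_left hgx, norm_inv]
    change ‖((l - algebraMap ℂ A a) * g).1 x‖ ≤ 1
    rw [hval, norm_mul, hgn, ← div_eq_mul_inv, div_le_one hpos]
    refine le_of_sq_le_sq ?_ hpos.le
    have h := normSq_one_sub_conj_mul_sub a (L x)
    have h1 : 0 ≤ (1 - ‖L x‖ ^ 2) * (1 - ‖a‖ ^ 2) :=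
      mul_nonneg (sub_nonneg.2 (pow_le_one₀ (norm_nonneg _) (hlx x)))
        (sub_nonneg.2 (pow_le_one₀ (norm_nonneg _) ha.le))
    linarith
  · have h1 : φ l = z L := hφ L
    have h2 := congrArg φ hg
    rw [map_mul, map_sub, AlgHom.map_smul_of_tower, map_one, h1, smul_eq_mul] at h2
    rw [map_mul, map_sub, AlgHom.commutes, h1, mul_assoc, h2, mul_one]
    rfl

/-- Contractivity bounds the set above, so its `sSup` is a genuine supremum. -/
theorem norm_le_rho {A : Subalgebra ℂ (UnitBall X →ᵇ ℂ)} (hA : A = Au X ∨ A = Hinf X)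
    {φ ψ : A →ₐ[ℂ] ℂ} {f : A} (hf : ‖f‖ ≤ 1) (hψ : ψ f = 0) : ‖φ f‖ ≤ rho φ ψ := by
  refine le_csSup ⟨1, ?_⟩ ⟨f, hf, hψ, rfl⟩
  rintro _ ⟨g, hg, -, rfl⟩
  exact (norm_algHom_apply_le hA φ g).trans hg

theorem rho_le {X : Type*} [NormedAddCommGroup X] {A : Subalgebra ℂ (UnitBall X →ᵇ ℂ)} {φ ψ : A →ₐ[ℂ] ℂ} {c : ℝ}
    (h : ∀ f : A, ‖f‖ ≤ 1 → ψ f = 0 → ‖φ f‖ ≤ c) : rho φ ψ ≤ c := by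
  refine csSup_le ⟨0, 0, by simp⟩ ?_
  rintro _ ⟨f, hf, hψ, rfl⟩
  exact h f hf hψ

/-- Characters over the sphere and characters over the open ball are at maximal distance. -/
theorem rho_eq_one_of_mem_fiber {A : Subalgebra ℂ (UnitBall X →ᵇ ℂ)} (hA : A = Au X ∨ A = Hinf X)
    {z w : Bidual X} (hz : ‖z‖ = 1) (hw : ‖w‖ < 1) {φ ψ : A →ₐ[ℂ] ℂ} (hφ : φ ∈ fiber hA z)
    (hψ : ψ ∈ fiber hA w) : rho φ ψ = 1 := by
  refine le_antisymm (rho_le fun f hf _ => (norm_algHom_apply_le hA φ f).trans hf) ?_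
  have hρ0 : 0 ≤ rho φ ψ := by
    simpa using norm_le_rho hA (φ := φ) (ψ := ψ) (f := 0) (by simp) (map_zero ψ)
  set k := 1 - ‖w‖ with hk
  have hk0 : 0 < k := sub_pos.2 hw
  refine le_of_sq_le_sq ?_ hρ0
  rw [one_pow]
  refine le_of_forall_pos_le_add fun ε hε => ?_
  -- The threshold gives `1 - ‖z L‖² ≤ ε k²`, while the Möbius denominator is at least `k`; hence `1
  -- - ‖φ m‖² ≤ ε`.
  obtain ⟨L, hL, hzL⟩ := z.exists_lt_apply_of_lt_opNorm (r := 1 - ε * k ^ 2 / 2)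
    (by rw [hz]; linarith [show 0 < ε * k ^ 2 / 2 by positivity])
  have hzL1 : ‖z L‖ ≤ 1 := (z.le_opNorm L).trans (by rw [hz, one_mul]; exact hL.le)
  have hwL : ‖w L‖ ≤ ‖w‖ := (w.le_opNorm L).trans (mul_le_of_le_one_right (norm_nonneg w) hL.le)
  obtain ⟨m, hm, hm'⟩ := exists_moebius hA hL.le (hwL.trans_lt hw)
  have hden : k ≤ ‖1 - conj (w L) * z L‖ :=
    (sub_le_sub_left hwL 1).trans (one_sub_norm_le_norm_one_sub_conj_mul hzL1)
  have hψm : ψ m = 0 := by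
    have h := hm' ψ w hψ
    rw [sub_self, mul_eq_zero] at h
    refine h.resolve_right (norm_pos_iff.1 (lt_of_lt_of_le ?_
      (one_sub_norm_le_norm_one_sub_conj_mul (hwL.trans hw.le))))
    linarith
  have hle : ‖φ m‖ ^ 2 ≤ rho φ ψ ^ 2 := by
    gcongr
    exact norm_le_rho hA hm hψm
  have hφm := congrArg (fun c : ℂ => ‖c‖ ^ 2) (hm' φ z hφ)
  simp only [norm_mul, mul_pow] at hφm
  have hid := normSq_one_sub_conj_mul_sub (w L) (z L)
  set D := ‖1 - conj (w L) * z L‖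
  have hD : k ^ 2 ≤ D ^ 2 := by gcongr
  have h1 : (1 - ‖z L‖ ^ 2) * (1 - ‖w L‖ ^ 2) ≤ ε * k ^ 2 := by
    have e1 : 1 - ‖z L‖ ^ 2 ≤ ε * k ^ 2 := by nlinarith [norm_nonneg (z L)]
    have e2 : 0 ≤ 1 - ‖z L‖ ^ 2 := sub_nonneg.2 (pow_le_one₀ (norm_nonneg _) hzL1)
    have e3 : 1 - ‖w L‖ ^ 2 ≤ 1 := by linarith [sq_nonneg ‖w L‖]
    exact (mul_le_of_le_one_right e2 e3).trans e1
  have h2 : (1 - ‖φ m‖ ^ 2) * D ^ 2 ≤ ε * D ^ 2 := by nlinarith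
  have h3 := le_of_mul_le_mul_right h2 (lt_of_lt_of_le (by positivity) hD)
  linarith

/-! ### The Schwarz lemma, the characters `δ_z` and part (a) -/

/-- The Schwarz–Pick estimate at the centre of the disc for a function vanishing at `r`. -/
theorem norm_apply_zero_le_of_apply_eq_zero {g : ℂ → ℂ}
    (hd : DifferentiableOn ℂ g (Metric.ball 0 1)) (hb : ∀ c ∈ Metric.ball (0 : ℂ) 1, ‖g c‖ ≤ 1)
    {r : ℝ} (hr0 : 0 ≤ r) (hr : r < 1) (hg : g r = 0) : ‖g 0‖ ≤ r := by
  have hrn : ‖(r : ℂ)‖ = r := by simp [abs_of_nonneg hr0]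
  have hden : ∀ c ∈ Metric.ball (0 : ℂ) 1, 1 - r ≤ ‖1 - (r : ℂ) * c‖ := fun c hc => by
    simpa [abs_of_nonneg hr0] using one_sub_norm_le_norm_one_sub_conj_mul (a := (r : ℂ))
      (mem_ball_zero_iff.1 hc).le
  have hne : ∀ c ∈ Metric.ball (0 : ℂ) 1, 1 - (r : ℂ) * c ≠ 0 := fun c hc =>
    norm_pos_iff.1 ((sub_pos.2 hr).trans_le (hden c hc))
  -- This disc automorphism exchanges `0` and `r`, so `g ∘ μ` vanishes at `0` and the Schwarz lemma
  -- at `r` bounds `g 0`.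
  let μ : ℂ → ℂ := fun c => (r - c) / (1 - r * c)
  have hμ : Set.MapsTo μ (Metric.ball 0 1) (Metric.ball 0 1) := fun c hc => by
    have hc1 : ‖c‖ < 1 := mem_ball_zero_iff.1 hc
    have hpos := norm_pos_iff.2 (hne c hc)
    rw [mem_ball_zero_iff, norm_div, div_lt_one hpos, norm_sub_rev]
    have h := normSq_one_sub_conj_mul_sub (r : ℂ) c
    rw [Complex.conj_ofReal, hrn] at h
    have h1 : 0 < (1 - ‖c‖ ^ 2) * (1 - r ^ 2) :=
      mul_pos (sub_pos.2 (pow_lt_one₀ (norm_nonneg _) hc1 two_ne_zero))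
        (sub_pos.2 (pow_lt_one₀ hr0 hr two_ne_zero))
    exact lt_of_pow_lt_pow_left₀ 2 hpos.le (by linarith)
  have hμd : DifferentiableOn ℂ μ (Metric.ball 0 1) :=
    DifferentiableOn.div (by fun_prop) (by fun_prop) hne
  have h := Complex.norm_le_norm_of_mapsTo_ball (f := g ∘ μ) (z := r) (hd.comp hμd hμ)
    (fun c hc => by simpa using hb _ (hμ hc)) (by simp [μ, hg]) (by rwa [hrn])
  simpa [μ, hrn, abs_of_nonneg hr0] using h

theorem taylorExtension_smul (f : UnitBall X → ℂ) (c : ℂ) (z : Bidual X) (n : ℕ) :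
    taylorExtension f (c • z) n = c ^ n * taylorExtension f z n :=
  multilinearExtension_smul n c (fun _ => z) _

/-- By homogeneity this is a power series in `c`; absolute convergence at `c = s` dominates it on
the disc of radius `s`. -/
theorem differentiableOn_canonicalExtension_smul {f : UnitBall X → ℂ} {z : Bidual X}
    (hs : ∀ c : ℂ, ‖c‖ < 1 → Summable (taylorExtension f (c • z))) :
    DifferentiableOn ℂ (fun c : ℂ => canonicalExtension f (c • z)) (Metric.ball 0 1) := by
  intro c hc
  obtain ⟨s, hcs, hs1⟩ := exists_between (mem_ball_zero_iff.1 hc)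
  have hs0 : 0 ≤ s := (norm_nonneg c).trans hcs.le
  have hsum := (hs (s : ℂ) (by simpa [abs_of_nonneg hs0] using hs1)).norm
  have h : DifferentiableOn ℂ (fun c : ℂ => ∑' n, taylorExtension f (c • z) n)
      (Metric.ball 0 s) := by
    refine Complex.differentiableOn_tsum_of_summable_norm hsum (fun n => ?_)
      Metric.isOpen_ball fun n w hw => ?_
    · simp only [taylorExtension_smul]
      fun_prop
    · have hw' : ‖w‖ ≤ s := (mem_ball_zero_iff.1 hw).le
      simp only [taylorExtension_smul, norm_mul, norm_pow, Complex.norm_real, Real.norm_eq_abs,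
        abs_of_nonneg hs0]
      gcongr
  exact (h.differentiableAt (Metric.isOpen_ball.mem_nhds
    (mem_ball_zero_iff.2 hcs))).differentiableWithinAt

/-- Evaluation of the canonical extension at a point of the open bidual ball is a character. -/
theorem exists_algHom_eq_canonicalExtension {A : Subalgebra ℂ (UnitBall X →ᵇ ℂ)}
    (hA : A = Au X ∨ A = Hinf X) (z : UnitBall (Bidual X)) :
    ∃ δ : A →ₐ[ℂ] ℂ, (∀ f : A, Summable (taylorExtension f.1 z.1) ∧
      δ f = canonicalExtension f.1 z.1) ∧ δ ∈ fiber hA z.1 := by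
  obtain ⟨l, hl, hlL, hlf⟩ :=
    exists_filter_tendsto_canonicalExtension z.1 (norm_coe_lt_one z)
  -- Canonical extensions are limits of values along one filter, so uniqueness of limits transfers
  -- the algebra identities.
  have ht : ∀ f : A, Tendsto f.1 l (𝓝 (canonicalExtension f.1 z.1)) := fun f =>
    (hlf f.1 (isHolo_of_mem hA f.2)).2
  have hconst : ∀ c : ℂ, canonicalExtension (algebraMap ℂ A c).1 z.1 = c := fun c => by
    refine tendsto_nhds_unique (ht _) (tendsto_const_nhds.congr fun x => ?_)
    change c = algebraMap ℂ (UnitBall X →ᵇ ℂ) c x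
    simp [BoundedContinuousFunction.algebraMap_apply]
  have hadd : ∀ f g : A, canonicalExtension (f + g).1 z.1 =
      canonicalExtension f.1 z.1 + canonicalExtension g.1 z.1 := fun f g =>
    tendsto_nhds_unique (ht (f + g)) ((ht f).add (ht g))
  have hmul : ∀ f g : A, canonicalExtension (f * g).1 z.1 =
      canonicalExtension f.1 z.1 * canonicalExtension g.1 z.1 := fun f g =>
    tendsto_nhds_unique (ht (f * g)) ((ht f).mul (ht g))
  let δ : A →ₐ[ℂ] ℂ :=
    { toFun := fun f => canonicalExtension f.1 z.1
      map_one' := by simpa using hconst 1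
      map_mul' := hmul
      map_zero' := by simpa using hconst 0
      map_add' := hadd
      commutes' := hconst }
  exact ⟨δ, fun f => ⟨(hlf f.1 (isHolo_of_mem hA f.2)).1, rfl⟩, fun L =>
    tendsto_nhds_unique (ht ⟨restrictDual L, restrictDual_mem hA L⟩) (hlL L)⟩

/-- Upper bound: the Schwarz estimate for `c ↦ f̃(c z₀)`, which vanishes at `‖z‖`. Lower bound: the
Möbius transform with `a = z(L)` vanishes at `δ z` and takes the value `-z(L)` at `δ 0`. -/
theorem rho_zero_eq_norm {A : Subalgebra ℂ (UnitBall X →ᵇ ℂ)} (hA : A = Au X ∨ A = Hinf X)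
    {δ : UnitBall (Bidual X) → (A →ₐ[ℂ] ℂ)}
    (hδ : ∀ (z : UnitBall (Bidual X)) (f : A), Summable (taylorExtension f.1 z.1) ∧
      δ z f = canonicalExtension f.1 z.1)
    (hfib : ∀ z, δ z ∈ fiber hA z.1) (z : UnitBall (Bidual X)) :
    rho (δ ⟨0, Metric.mem_ball_self one_pos⟩) (δ z) = ‖z.1‖ := by
  have hz : ‖z.1‖ < 1 := norm_coe_lt_one z
  refine le_antisymm (rho_le fun f hf hψ => ?_) (le_of_forall_lt fun c hc => ?_)
  · rcases eq_or_ne z.1 0 with h0 | h0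
    · have : z = ⟨0, Metric.mem_ball_self one_pos⟩ := Subtype.ext h0
      rw [← this, hψ, norm_zero]
      exact norm_nonneg z.1
    · obtain ⟨z₀, hn, hzz⟩ := exists_norm_eq_one_smul_eq (E := Bidual X) h0
      have hball : ∀ c : ℂ, ‖c‖ < 1 → c • z₀ ∈ Metric.ball (0 : Bidual X) 1 := fun c hc =>
        smul_mem_ball_of_norm_eq_one (E := Bidual X) hn hc
      have hd := differentiableOn_canonicalExtension_smul (f := f.1) (z := z₀)
        fun c hc => (hδ ⟨c • z₀, hball c hc⟩ f).1
      have h := norm_apply_zero_le_of_apply_eq_zero hd (fun c hc => ?_) (norm_nonneg z.1) hz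
        (by rw [hzz, ← (hδ z f).2, hψ])
      · have hzero : (0 : ℂ) • z₀ = 0 := zero_smul ℂ z₀
        rw [hzero] at h
        rwa [(hδ _ f).2]
      · rw [← (hδ ⟨c • z₀, hball c (mem_ball_zero_iff.1 hc)⟩ f).2]
        exact (norm_algHom_apply_le hA _ f).trans hf
  · obtain ⟨L, hL, hcL⟩ := z.1.exists_lt_apply_of_lt_opNorm hc
    refine hcL.trans_le ?_
    have hzL : ‖z.1 L‖ < 1 := (z.1.le_opNorm L).trans_lt
      ((mul_le_of_le_one_right (norm_nonneg _) hL.le).trans_lt hz)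
    obtain ⟨m, hm, hm'⟩ := exists_moebius hA hL.le hzL
    have h0 := hm' _ _ (hfib ⟨0, Metric.mem_ball_self one_pos⟩)
    have h1 := hm' _ _ (hfib z)
    rw [sub_self, mul_eq_zero] at h1
    have h2 : 1 - conj (z.1 L) * z.1 L ≠ 0 := norm_pos_iff.1
      ((sub_pos.2 hzL).trans_le (one_sub_norm_le_norm_one_sub_conj_mul hzL.le))
    simp only [zero_apply, mul_zero, sub_zero, mul_one, zero_sub] at h0
    have h3 := norm_le_rho hA (φ := δ ⟨0, Metric.mem_ball_self one_pos⟩) hm (h1.resolve_right h2)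
    rwa [h0, norm_neg] at h3

end BallAlgebra

end

theorem mainTheorem9 {X : Type*} [NormedAddCommGroup X] [NormedSpace ℂ X] [CompleteSpace X]
    (A : Subalgebra ℂ (BoundedContinuousFunction (BallAlgebra.UnitBall X) ℂ))
    (hA : A = BallAlgebra.Au X ∨ A = BallAlgebra.Hinf X) :
    (∃ δ : BallAlgebra.UnitBall (BallAlgebra.Bidual X) → (A →ₐ[ℂ] ℂ),
      (∀ (z : BallAlgebra.UnitBall (BallAlgebra.Bidual X)) (f : A),
        Summable (BallAlgebra.taylorExtension f.1 z.1) ∧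
          δ z f = BallAlgebra.canonicalExtension f.1 z.1) ∧
      (∀ z, δ z ∈ BallAlgebra.GP (δ ⟨0, Metric.mem_ball_self one_pos⟩)) ∧
      (∀ z, BallAlgebra.rho (δ ⟨0, Metric.mem_ball_self one_pos⟩) (δ z) = ‖z.1‖)) ∧
    (∀ z ∈ Metric.sphere (0 : BallAlgebra.Bidual X) 1,
      ∀ w ∈ Metric.ball (0 : BallAlgebra.Bidual X) 1,
        ∀ φ ∈ BallAlgebra.fiber hA z, ∀ ψ ∈ BallAlgebra.fiber hA w,
          BallAlgebra.rho φ ψ = 1 ∧ BallAlgebra.GP φ ≠ BallAlgebra.GP ψ) := by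
  constructor
  · choose δ hδ hfib using BallAlgebra.exists_algHom_eq_canonicalExtension hA
    have hρ := BallAlgebra.rho_zero_eq_norm hA hδ hfib
    exact ⟨δ, hδ, fun z => (hρ z).trans_lt (BallAlgebra.norm_coe_lt_one z), hρ⟩
  · intro z hz w hw φ hφ ψ hψ
    have hρ := BallAlgebra.rho_eq_one_of_mem_fiber hA ((dist_zero_right z).symm.trans hz)
      (BallAlgebra.norm_coe_lt_one ⟨w, hw⟩) hφ hψ
    refine ⟨hρ, fun h => ?_⟩
    -- Since `ρ(ψ, ψ) ≤ 0`, `ψ` lies in its own part, while `ρ(φ, ψ) = 1` keeps it out of that of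
    -- `φ`; transitivity of the relation plays no role.
    have hself : ψ ∈ BallAlgebra.GP ψ :=
      (BallAlgebra.rho_le fun f _ hf => (by rw [hf, norm_zero])).trans_lt one_pos
    rw [← h] at hself
    exact hself.ne hρ
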